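/- Let $M\subset\mathbb R^q$ be a non-empty compact set with $\overline{\operatorname{int} M}=M$, and let $m$ be the Lebesgue measure on $M$ normalized by $m(M)=1$. Let $T:M\to M$ be measurable and non-singular with respect to $m$, with set of discontinuities of $m$-measure zero, and let $\mathcal L:L^1(m)\to L^1(m)$ be its transfer operator, given by $\int_M f\cdot(\varphi\circ T)\,dm=\int_M (\mathcal L f)\,\varphi\,dm$ for bounded measurable $\varphi$. For every $\varepsilon>0$ let $(\mathcal X^\varepsilon_n)$ be a Markov chain on $M$ with transition probabilities $P_\varepsilon(x,\cdot)$ such that, for all $x\in M$, $P_\varepsilon(x,\cdot)$ has a density $p_\varepsilon(x,\cdot)$ with respect to $m$, and the support of the measure $P_\varepsilon(x,\cdot)$ is the closure of the ball $B_\varepsilon(Tx)=\{y\in M: |y-Tx|<\varepsilon\}$. Let $\mathcal L_\varepsilon f(y)=\int_M p_\varepsilon(x,y)f(x)\,dm(x)$ for $f\in L^1(m)$. Let $\mathcal B\subset L^1(m)$ be a dense linear subspace with a semi-norm $|\cdot|$ such that: the constant function $1$ belongs to $\mathcal B$; every $f\in\mathcal B$ has a version whose set of discontinuities is $m$-null;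 $\mathcal B$ is complete for the norm $\|f\|_{\mathcal B}=|f|+\|f\|_{L^1(m)}$; and the unit ball of $(\mathcal B,\|\cdot\|_{\mathcal B})$ is compact in $L^1(m)$. Suppose there are $\eta\in(0,1)$ and $D\in(0,\infty)$ such that $\mathcal L$ and, for all sufficiently small $\varepsilon>0$, $\mathcal L_\varepsilon$ map $\mathcal B$ into itself and satisfy, for all $f\in\mathcal B$, $$|\mathcal L f|\le\eta|f|+D\|f\|_{L^1(m)},\qquad |\mathcal L_\varepsilon f|\le\eta|f|+D\|f\|_{L^1(m)} .$$ An acim is a $T$-invariant Borel probability measure on $M$ that is absolutely continuous with respect to $m$. An acsm of $(\mathcal X^\varepsilon_n)$ is a Borel probability measure $\mu$ on $M$ that is absolutely continuous with respect to $m$ and satisfies $\mu(A)=\int_M P_\varepsilon(x,A)\,d\mu(x)$ for all Borel sets $A$; it is ergodic if every Borel set $A$ with $P_\varepsilon(x,A)=1_A(x)$ for $\mu$-almost every $x$ has $\mu(A)\in\{0,1\}$. Then $T$ has only finitely many ergodic acims, and there is $\varepsilon_0>0$ such that for all $\varepsilon\in(0,\varepsilon_0)$ the number of ergodic acsms of $(\mathcal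 X^\varepsilon_n)$ is at most the number of ergodic acims of $T$. Moreover, for these $\varepsilon$, if $T$ has a unique acim, then $(\mathcal X^\varepsilon_n)$ has a unique acsm. -/

import Mathlib

open MeasureTheory ProbabilityTheory Filter Topology

/-- Normalized Lebesgue measure on a subset `M` of `ℝ^q`, as a measure on the subtype `M`. -/
noncomputable def normalizedLebesgue {q : ℕ} (M : Set (EuclideanSpace ℝ (Fin q))) : Measure M :=
  (volume M)⁻¹ • Measure.comap Subtype.val volume

section MeasureSpaces

variable {X : Type*} [MeasurableSpace X]

/-- An absolutely continuous invariant probability measure (acim) of `T`. -/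
structure IsAcim (m : Measure X) (T : X → X) (μ : Measure X) : Prop where
  isProbabilityMeasure : IsProbabilityMeasure μ
  absolutelyContinuous : μ ≪ m
  invariant : MeasurePreserving T μ μ

/-- An ergodic acim of `T`. -/
structure IsErgodicAcim (m : Measure X) (T : X → X) (μ : Measure X) : Prop where
  isAcim : IsAcim m T μ
  ergodic : Ergodic T μ

/-- An absolutely continuous stationary probability measure (acsm) of the Markov chain with
transition probabilities `κ`; `Kernel.Invariant κ μ` says `μ A = ∫ κ(x, A) dμ(x)` for all
measurable `A`. -/
structure IsAcsm (m : Measure X) (κ : Kernel X X) (μ : Measure X) : Prop where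
  isProbabilityMeasure : IsProbabilityMeasure μ
  absolutelyContinuous : μ ≪ m
  stationary : Kernel.Invariant κ μ

/-- An ergodic acsm: a measurable set `A` with `κ(x, A) = 1_A(x)` for `μ`-almost every `x` has
`μ`-measure `0` or `1`. -/
structure IsErgodicAcsm (m : Measure X) (κ : Kernel X X) (μ : Measure X) : Prop where
  isAcsm : IsAcsm m κ μ
  ergodic : ∀ A : Set X, MeasurableSet A →
    (fun x => κ x A) =ᵐ[μ] A.indicator (fun _ => 1) → μ A = 0 ∨ μ A = 1

/-- `g = 𝓛 f` for the transfer (Perron-Frobenius) operator `𝓛` of `T` on `L¹(m)`, which is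
defined by duality with bounded measurable functions. -/
def IsTransfer (m : Measure X) (T : X → X) (f g : Lp ℝ 1 m) : Prop :=
  ∀ φ : X → ℝ, Measurable φ → (∃ C : ℝ, ∀ x, |φ x| ≤ C) →
    ∫ x, f x * φ (T x) ∂m = ∫ x, g x * φ x ∂m

/-- The jointly measurable density `p(x, y)` of `κ(x, ·)` with respect to `m`. -/
noncomputable def transitionDensity [MeasurableSpace.CountableOrCountablyGenerated X X]
    (m : Measure X) (κ : Kernel X X) (x y : X) : ℝ :=
  (Kernel.rnDeriv κ (Kernel.const X m) x y).toReal

/-- `g = 𝓛_ε f` for the transfer operator `𝓛_ε f (y) = ∫ p(x, y) f(x) dm(x)` on `L¹(m)` of the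
Markov chain with transition probabilities `κ`. -/
def IsRandomTransfer [MeasurableSpace.CountableOrCountablyGenerated X X]
    (m : Measure X) (κ : Kernel X X) (f g : Lp ℝ 1 m) : Prop :=
  ∀ᵐ y ∂m, g y = ∫ x, transitionDensity m κ x y * f x ∂m

/-- The Lasota-Yorke inequality `|Q f| ≤ η |f| + D ‖f‖₁` on `B` for an operator `Q` on `L¹(m)`
that maps `B` to itself. The operator is given by its graph: `Q f g` means `g = Q f`. -/
def LasotaYorke {m : Measure X} (B : Submodule ℝ (Lp ℝ 1 m)) (s : Seminorm ℝ B)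
    (Q : Lp ℝ 1 m → Lp ℝ 1 m → Prop) (η D : ℝ) : Prop :=
  ∀ f : B, ∃ g : B, Q f g ∧ s g ≤ η * s f + D * ‖(f : Lp ℝ 1 m)‖

/-- The standing assumptions on the Banach space `B ⊆ L¹(m)` with norm `|f| + ‖f‖₁`, where
`|f| = s f`. -/
structure IsAdaptedSpace [TopologicalSpace X] {m : Measure X}
    (B : Submodule ℝ (Lp ℝ 1 m)) (s : Seminorm ℝ B) : Prop where
  dense : Dense (B : Set (Lp ℝ 1 m))
  one_mem : ∃ u : B, ∀ᵐ x ∂m, (u : Lp ℝ 1 m) x = 1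
  null_discontinuities : ∀ f : B, ∃ f' : X → ℝ,
    (f : Lp ℝ 1 m) =ᵐ[m] f' ∧ m {x | ¬ ContinuousAt f' x} = 0
  complete : ∀ u : ℕ → B,
    (∀ δ > 0, ∃ N, ∀ i ≥ N, ∀ j ≥ N, s (u i - u j) + ‖u i - u j‖ < δ) →
      ∃ f : B, Tendsto (fun n => s (u n - f) + ‖u n - f‖) atTop (𝓝 0)
  compact_unitBall : IsCompact ((fun f : B => (f : Lp ℝ 1 m)) '' {f : B | s f + ‖f‖ ≤ 1})

end MeasureSpaces

/-!
The transfer operators of `T` and of the chain are both transfer operators of Markov kernels on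
`L¹(m)`, the kernel of `T` being `x ↦ δ_{T x}`. They are positive contractions that preserve the
integral, and their nonnegative fixed points are the stationary densities.

Functional analysis: by the Lasota-Yorke inequality and the compactness of the unit ball of `B`,
ergodic averages of elements of `B` accumulate at fixed points. As `B` is dense, every nonempty
closed convex invariant subset of `L¹(m)` contains a fixed point that lies in `B`
(`exists_fixedPoint_of_lasotaYorke`). Applied to a singleton, this says that all fixed points lie
in `B`; applied to the densities that vanish off a set `W` which cannot be left, it gives a
stationary density in `W`. The fixed points of norm at most one form a compact set.

Ergodicity: an extreme point of the stationary densities in `W` is ergodic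
(`exists_isErgodicAcsm_of_invariant`). The positive part of a fixed point is a fixed point, so
different ergodic densities have disjoint supports (`ae_disjoint_of_ergodic`). They then have
distance `2`, so compactness leaves only finitely many of them.

Comparison: a stationary density of the chain lies in `B`, hence its support is an open set `U`
modulo `m`. The chain does not leave `U`, and the noise has full support in the `ε`-balls, so `T`
maps almost all of `interior (closure U)` into itself (`ae_mem_interior_closure`), and this set
carries an ergodic acim of `T`. Disjoint `U` have disjoint `interior (closure U)`, so different
ergodic acsms give different ergodic acims. If there were two acsms, the positive and negative parts
of the difference of their densities would be disjointly supported stationary densities, which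
would lead to two acims. No smallness of `ε` is needed beyond the Lasota-Yorke inequality for the
chain.
-/

/-! ### Fixed points of Lasota-Yorke operators -/

section FixedPoints

variable {E : Type*} [NormedAddCommGroup E] [NormedSpace ℝ E] {B : Submodule ℝ E}
  {s : Seminorm ℝ B} {A : E →L[ℝ] E} {η D : ℝ}

/-- Ergodic averages `x` of `f ∈ B` are almost fixed by `A`, have a `B`-norm that is bounded in
terms of `‖f‖` alone, and stay as close to an `A`-invariant convex set as `f` is. -/
theorem exists_almost_fixedPoint_of_lasotaYorke (hA : ∀ f, ‖A f‖ ≤ ‖f‖) (hη1 : η < 1)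
    (hLY : ∀ f : B, ∃ g : B, (g : E) = A f ∧ s g ≤ η * s f + D * ‖(f : E)‖) (hD : 0 ≤ D)
    {C : Set E} (hCconv : Convex ℝ C) (hCA : Set.MapsTo A C C) (f : B) {c : E} (hc : c ∈ C)
    {δ : ℝ} (hδ : 0 < δ) :
    ∃ x : B, ∃ c' ∈ C, s x ≤ δ + D / (1 - η) * ‖(f : E)‖ ∧ ‖(x : E)‖ ≤ ‖(f : E)‖ ∧
      ‖A x - x‖ ≤ δ ∧ ‖(x : E) - c'‖ ≤ ‖(f : E) - c‖ := by
  choose G hGA hGs using hLY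
  have hcoe : ∀ j, ((G^[j] f : B) : E) = A^[j] (f : E) := by
    intro j
    induction j with
    | zero => rfl
    | succ j ih => rw [Function.iterate_succ_apply', Function.iterate_succ_apply', hGA, ih]
  have hnorm : ∀ (j : ℕ) (v : E), ‖A^[j] v‖ ≤ ‖v‖ := by
    intro j v
    induction j with
    | zero => rfl
    | succ j ih => rw [Function.iterate_succ_apply']; exact (hA _).trans ih
  have hiter : ∀ (j : ℕ) (v w : E), A^[j] v - A^[j] w = A^[j] (v - w) := by
    intro j v w
    induction j with
    | zero => rfl
    | succ j ih => simp only [Function.iterate_succ_apply', ← ih, map_sub]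
  have hmem : ∀ j, A^[j] c ∈ C := fun j => hCA.iterate j hc
  -- The quantity on the left grows by at most `D * ‖f‖` at each step.
  have hsum : ∀ n : ℕ, s (G^[n] f) + (1 - η) * ∑ j ∈ Finset.range n, s (G^[j] f) ≤
      s f + n * (D * ‖(f : E)‖) := by
    intro n
    induction n with
    | zero => simp
    | succ n ih =>
      have h1 := hGs (G^[n] f)
      have h2 : D * ‖((G^[n] f : B) : E)‖ ≤ D * ‖(f : E)‖ := by
        rw [hcoe]; exact mul_le_mul_of_nonneg_left (hnorm n _) hD
      rw [Finset.sum_range_succ, Function.iterate_succ_apply']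
      push_cast
      linarith
  have hη : 0 < 1 - η := by linarith
  obtain ⟨n, hn⟩ := exists_nat_gt (max (s f / ((1 - η) * δ)) (2 * ‖(f : E)‖ / δ))
  have hn1 := (le_max_left _ _).trans_lt hn
  have hn2 := (le_max_right _ _).trans_lt hn
  have hn0 : (0 : ℝ) < n := lt_of_le_of_lt (by positivity) hn2
  have hn0' : (n : ℝ) ≠ 0 := hn0.ne'
  rw [div_lt_iff₀ (by positivity)] at hn1 hn2
  refine ⟨(n : ℝ)⁻¹ • ∑ j ∈ Finset.range n, G^[j] f,
    ∑ j ∈ Finset.range n, (n : ℝ)⁻¹ • A^[j] c, ?_, ?_, ?_, ?_, ?_⟩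
  · exact hCconv.sum_mem (fun _ _ => by positivity) (by simp [hn0']) (fun j _ => hmem j)
  · rw [map_smul_eq_mul, Real.norm_of_nonneg (by positivity), inv_mul_le_iff₀ hn0]
    have h1 : s (∑ j ∈ Finset.range n, G^[j] f) ≤ ∑ j ∈ Finset.range n, s (G^[j] f) :=
      Finset.le_sum_of_subadditive s (map_zero s).le (map_add_le_add s) _ _
    refine h1.trans ?_
    have h2 := hsum n
    have h3 : 0 ≤ s (G^[n] f) := apply_nonneg s _
    have h4 : ∑ j ∈ Finset.range n, s (G^[j] f) ≤ (s f + n * (D * ‖(f : E)‖)) / (1 - η) := by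
      rw [le_div_iff₀ hη]; linarith
    refine h4.trans ?_
    rw [div_le_iff₀ hη]
    have : n * (δ + D / (1 - η) * ‖(f : E)‖) * (1 - η) =
        n * ((1 - η) * δ) + n * (D * ‖(f : E)‖) := by
      field_simp
    linarith
  · simp only [Submodule.coe_smul, Submodule.coe_sum, norm_smul, norm_inv, RCLike.norm_natCast,
      hcoe]
    rw [inv_mul_le_iff₀ hn0]
    refine (norm_sum_le_of_le _ (fun j _ => hnorm j _)).trans ?_
    simp
  · simp only [Submodule.coe_smul, Submodule.coe_sum, hcoe, map_smul, map_sum, ← smul_sub,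
      ← Finset.sum_sub_distrib, ← Function.iterate_succ_apply' (⇑A)]
    rw [Finset.sum_range_sub (fun j => A^[j] (f : E)), norm_smul, norm_inv, RCLike.norm_natCast,
      inv_mul_le_iff₀ hn0]
    refine (norm_sub_le _ _).trans ?_
    have := hnorm n f
    simp only [Function.iterate_zero, id]
    linarith
  · rw [← Finset.smul_sum]
    simp only [Submodule.coe_smul, Submodule.coe_sum, hcoe, ← smul_sub,
      ← Finset.sum_sub_distrib, hiter, norm_smul, norm_inv, RCLike.norm_natCast]
    rw [inv_mul_le_iff₀ hn0]
    refine (norm_sum_le_of_le _ (fun j _ => hnorm j _)).trans ?_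
    simp

/-- Balls of arbitrary radius inherit compactness from the unit ball. -/
theorem isCompact_image_ball
    (hB : IsCompact ((fun f : B => (f : E)) '' {f : B | s f + ‖f‖ ≤ 1})) (R : ℝ) :
    ∃ K : Set E, IsCompact K ∧ (∀ f : B, s f + ‖f‖ ≤ R → (f : E) ∈ K) ∧ K ⊆ B := by
  refine ⟨_, hB.image (continuous_const_smul (max R 1)), ?_, ?_⟩
  · intro f hf
    have hR : 0 < max R 1 := by positivity
    refine ⟨_, ⟨(max R 1)⁻¹ • f, ?_, rfl⟩, ?_⟩
    · simp only [Set.mem_ofPred_eq]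
      rw [map_smul_eq_mul, norm_smul, ← mul_add, Real.norm_of_nonneg (by positivity),
        inv_mul_le_iff₀ hR, mul_one]
      exact hf.trans (le_max_left _ _)
    · simp [smul_smul, mul_inv_cancel₀ hR.ne']
  · rintro _ ⟨_, ⟨f, -, rfl⟩, rfl⟩
    exact B.smul_mem _ f.2

/-- A Lasota-Yorke contraction has a fixed point, lying in `B`, in every nonempty closed convex
invariant set. The set need not meet `B`. -/
theorem exists_fixedPoint_of_lasotaYorke (hd : Dense (B : Set E))
    (hB : IsCompact ((fun f : B => (f : E)) '' {f : B | s f + ‖f‖ ≤ 1}))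
    (hA : ∀ f, ‖A f‖ ≤ ‖f‖) (hη1 : η < 1) (hD : 0 ≤ D)
    (hLY : ∀ f : B, ∃ g : B, (g : E) = A f ∧ s g ≤ η * s f + D * ‖(f : E)‖)
    {C : Set E} (hCconv : Convex ℝ C) (hCcl : IsClosed C) (hCA : Set.MapsTo A C C)
    (hCne : C.Nonempty) :
    ∃ h : B, (h : E) ∈ C ∧ A h = h ∧ s h ≤ D / (1 - η) * ‖(h : E)‖ := by
  obtain ⟨c, hc⟩ := hCne
  have hη : 0 < 1 - η := by linarith
  have hδ : ∀ k : ℕ, (0 : ℝ) < 1 / (k + 1) := fun k => by positivity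
  have hf : ∀ k : ℕ, ∃ f : B, ‖(f : E) - c‖ < 1 / (k + 1) := by
    intro k
    obtain ⟨f, hf, hfB⟩ := hd.exists_dist_lt c (hδ k)
    exact ⟨⟨f, hf⟩, by rwa [← dist_eq_norm, dist_comm]⟩
  choose f hf using hf
  choose x c' hc' hsx hnx hAx hxc using fun k =>
    exists_almost_fixedPoint_of_lasotaYorke hA hη1 hLY hD hCconv hCA (f k) hc (hδ k)
  have hδ1 : ∀ k : ℕ, (1 : ℝ) / (k + 1) ≤ 1 := fun k => by
    rw [div_le_one (by positivity)]; linarith [(Nat.cast_nonneg k : (0 : ℝ) ≤ k)]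
  have hfn : ∀ k, ‖(f k : E)‖ ≤ ‖c‖ + 1 := fun k => by
    have := norm_le_norm_add_norm_sub' (f k : E) c
    linarith [hf k, hδ1 k]
  obtain ⟨K, hK, hKmem, hKB⟩ := isCompact_image_ball hB (1 + (D / (1 - η) + 1) * (‖c‖ + 1))
  have hxK : ∀ k, (x k : E) ∈ K := by
    intro k
    apply hKmem
    have h1 : D / (1 - η) * ‖(f k : E)‖ ≤ D / (1 - η) * (‖c‖ + 1) :=
      mul_le_mul_of_nonneg_left (hfn k) (by positivity)
    have h2 : ‖x k‖ ≤ ‖c‖ + 1 := (hnx k).trans (hfn k)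
    linarith [hsx k, hδ1 k]
  obtain ⟨h, hhK, φ, hφ, hlim⟩ := hK.tendsto_subseq hxK
  have h0 : Tendsto (fun k => (1 : ℝ) / ((φ k : ℕ) + 1)) atTop (𝓝 0) :=
    tendsto_one_div_add_atTop_nhds_zero_nat.comp hφ.tendsto_atTop
  have hfix : A h = h := by
    have h1 : Tendsto (fun k => A (x (φ k)) - x (φ k)) atTop (𝓝 (A h - h)) :=
      ((A.continuous.tendsto h).comp hlim).sub hlim
    have h2 : Tendsto (fun k => A (x (φ k)) - x (φ k)) atTop (𝓝 0) :=
      squeeze_zero_norm (fun k => hAx (φ k)) h0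
    exact sub_eq_zero.1 (tendsto_nhds_unique h1 h2)
  have hhC : h ∈ C := by
    have h2 : Tendsto (fun k => (x (φ k) : E) - c' (φ k)) atTop (𝓝 0) :=
      squeeze_zero_norm (fun k => (hxc (φ k)).trans (hf (φ k)).le) h0
    have h3 : Tendsto (fun k => c' (φ k)) atTop (𝓝 h) := by
      simpa using hlim.sub h2
    exact hCcl.mem_of_tendsto h3 (Eventually.of_forall fun k => hc' _)
  refine ⟨⟨h, hKB hhK⟩, hhC, hfix, ?_⟩
  obtain ⟨g, hg, hs⟩ := hLY ⟨h, hKB hhK⟩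
  obtain rfl : g = ⟨h, hKB hhK⟩ := Subtype.ext (hg.trans hfix)
  rw [div_mul_eq_mul_div, le_div_iff₀ hη]
  linarith

/-- The fixed points of norm at most one of a Lasota-Yorke contraction form a compact set. -/
theorem isCompact_fixedPoints_of_lasotaYorke (hd : Dense (B : Set E))
    (hB : IsCompact ((fun f : B => (f : E)) '' {f : B | s f + ‖f‖ ≤ 1}))
    (hA : ∀ f, ‖A f‖ ≤ ‖f‖) (hη1 : η < 1) (hD : 0 ≤ D)
    (hLY : ∀ f : B, ∃ g : B, (g : E) = A f ∧ s g ≤ η * s f + D * ‖(f : E)‖) :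
    IsCompact {h : E | A h = h ∧ ‖h‖ ≤ 1} := by
  obtain ⟨K, hK, hKmem, -⟩ := isCompact_image_ball hB (D / (1 - η) + 1)
  have hη : 0 < 1 - η := by linarith
  refine hK.of_isClosed_subset ?_ ?_
  · exact (isClosed_eq A.continuous continuous_id).inter
      (isClosed_le continuous_norm continuous_const)
  · rintro h ⟨hfix, hn⟩
    obtain ⟨g, hg, -, hs⟩ := exists_fixedPoint_of_lasotaYorke hd hB hA hη1 hD hLY
      (convex_singleton h) isClosed_singleton (by simpa using hfix) (Set.singleton_nonempty h)
    rw [Set.mem_singleton_iff] at hg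
    rw [← hg]
    apply hKmem
    have : D / (1 - η) * ‖(g : E)‖ ≤ D / (1 - η) * 1 :=
      mul_le_mul_of_nonneg_left (hg ▸ hn) (by positivity)
    have : ‖g‖ ≤ 1 := by change ‖(g : E)‖ ≤ 1; rw [hg]; exact hn
    linarith

end FixedPoints

/-! ### Transfer operators of Markov kernels -/

section Transfer

variable {X : Type*} [MeasurableSpace X] {m : Measure X} {κ : Kernel X X}

/-- `g` is the image of `f` under the transfer operator on `L¹(m)` of the Markov kernel `κ`, which
is dual to `φ ↦ ∫ φ dκ(x, ·)` on bounded measurable functions. Both the transfer operator of a map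
`T` (for `κ(x, ·) = δ_{T x}`) and that of a chain with transition densities are of this form. -/
def IsKernelTransfer (m : Measure X) (κ : Kernel X X) (f g : Lp ℝ 1 m) : Prop :=
  ∀ φ : X → ℝ, Measurable φ → (∃ C : ℝ, ∀ x, |φ x| ≤ C) →
    ∫ x, f x * ∫ y, φ y ∂κ x ∂m = ∫ x, g x * φ x ∂m

theorem integrable_mul_of_bounded (f : Lp ℝ 1 m) {ψ : X → ℝ} (hψ : Measurable ψ) {C : ℝ}
    (hC : ∀ x, |ψ x| ≤ C) : Integrable (fun x => f x * ψ x) m :=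
  (L1.integrable_coeFn f).mul_bdd hψ.aestronglyMeasurable (ae_of_all _ hC)

theorem continuous_integral_mul {ψ : X → ℝ} (hψ : Measurable ψ) {C : ℝ} (hC : ∀ x, |ψ x| ≤ C) :
    Continuous fun f : Lp ℝ 1 m => ∫ x, f x * ψ x ∂m := by
  refine (LipschitzWith.of_dist_le_mul (K := C.toNNReal) fun f g => ?_).continuous
  rw [dist_eq_norm, dist_eq_norm, ← integral_sub (integrable_mul_of_bounded f hψ hC)
    (integrable_mul_of_bounded g hψ hC), L1.norm_eq_integral_norm, ← integral_const_mul]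
  refine norm_integral_le_of_norm_le ((L1.integrable_coeFn (f - g)).norm.const_mul _) ?_
  filter_upwards [Lp.coeFn_sub f g] with x hx
  rw [hx, ← sub_mul, norm_mul, mul_comm]
  refine mul_le_mul_of_nonneg_right ((hC x).trans (Real.le_coe_toNNReal C)) (norm_nonneg _)

theorem measurable_integral_kernel {φ : X → ℝ} (hφ : Measurable φ) :
    Measurable fun x => ∫ y, φ y ∂κ x :=
  hφ.stronglyMeasurable.integral_kernel.measurable

theorem abs_integral_kernel_le [IsMarkovKernel κ] {φ : X → ℝ} {C : ℝ} (hC : ∀ x, |φ x| ≤ C)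
    (x : X) : |∫ y, φ y ∂κ x| ≤ C := by
  simpa using norm_integral_le_of_norm_le_const (μ := κ x) (f := φ) (C := C) (ae_of_all _ hC)

theorem integrable_mul_kernel [IsMarkovKernel κ] (f : Lp ℝ 1 m) {S : Set X}
    (hS : MeasurableSet S) : Integrable (fun x => f x * (κ x).real S) m :=
  integrable_mul_of_bounded f (κ.measurable_coe hS).ennreal_toReal (C := 1)
    fun x => by rw [abs_of_nonneg measureReal_nonneg]; exact measureReal_le_one

theorem IsKernelTransfer.setIntegral {f g : Lp ℝ 1 m} (h : IsKernelTransfer m κ f g) {S : Set X}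
    (hS : MeasurableSet S) : ∫ x in S, g x ∂m = ∫ x, f x * (κ x).real S ∂m := by
  have := h (S.indicator 1) (measurable_one.indicator hS)
    ⟨1, fun x => by by_cases hx : x ∈ S <;> simp [hx]⟩
  simp only [integral_indicator_one hS] at this
  rw [this, ← integral_indicator hS]
  congr with x
  by_cases hx : x ∈ S <;> simp [hx]

theorem IsKernelTransfer.unique {f g g' : Lp ℝ 1 m} (h : IsKernelTransfer m κ f g)
    (h' : IsKernelTransfer m κ f g') : g = g' :=
  Lp.ext <| Integrable.ae_eq_of_forall_setIntegral_eq _ _ (L1.integrable_coeFn g)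
    (L1.integrable_coeFn g') fun _ hS _ => (h.setIntegral hS).trans (h'.setIntegral hS).symm

theorem IsKernelTransfer.add [IsMarkovKernel κ] {f g f' g' : Lp ℝ 1 m}
    (h : IsKernelTransfer m κ f g) (h' : IsKernelTransfer m κ f' g') :
    IsKernelTransfer m κ (f + f') (g + g') := by
  rintro φ hφ ⟨C, hC⟩
  have hκ := measurable_integral_kernel (κ := κ) hφ
  have hκC := abs_integral_kernel_le (κ := κ) hC
  have e1 : ∫ x, (f + f' : Lp ℝ 1 m) x * ∫ y, φ y ∂κ x ∂m =
      ∫ x, f x * ∫ y, φ y ∂κ x ∂m + ∫ x, f' x * ∫ y, φ y ∂κ x ∂m := by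
    rw [← integral_add (integrable_mul_of_bounded f hκ hκC) (integrable_mul_of_bounded f' hκ hκC)]
    refine integral_congr_ae ?_
    filter_upwards [Lp.coeFn_add f f'] with x hx
    rw [hx, Pi.add_apply, add_mul]
  have e2 : ∫ x, (g + g' : Lp ℝ 1 m) x * φ x ∂m = ∫ x, g x * φ x ∂m + ∫ x, g' x * φ x ∂m := by
    rw [← integral_add (integrable_mul_of_bounded g hφ hC) (integrable_mul_of_bounded g' hφ hC)]
    refine integral_congr_ae ?_
    filter_upwards [Lp.coeFn_add g g'] with x hx
    rw [hx, Pi.add_apply, add_mul]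
  rw [e1, e2, h φ hφ ⟨C, hC⟩, h' φ hφ ⟨C, hC⟩]

theorem IsKernelTransfer.smul {f g : Lp ℝ 1 m} (h : IsKernelTransfer m κ f g) (c : ℝ) :
    IsKernelTransfer m κ (c • f) (c • g) := by
  intro φ hφ hC
  have e1 : ∫ x, (c • f : Lp ℝ 1 m) x * ∫ y, φ y ∂κ x ∂m = c * ∫ x, f x * ∫ y, φ y ∂κ x ∂m := by
    rw [← integral_const_mul]
    refine integral_congr_ae ?_
    filter_upwards [Lp.coeFn_smul c f] with x hx
    rw [hx, Pi.smul_apply, smul_eq_mul, mul_assoc]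
  have e2 : ∫ x, (c • g : Lp ℝ 1 m) x * φ x ∂m = c * ∫ x, g x * φ x ∂m := by
    rw [← integral_const_mul]
    refine integral_congr_ae ?_
    filter_upwards [Lp.coeFn_smul c g] with x hx
    rw [hx, Pi.smul_apply, smul_eq_mul, mul_assoc]
  rw [e1, e2, h φ hφ hC]

theorem IsKernelTransfer.sub [IsMarkovKernel κ] {f g f' g' : Lp ℝ 1 m}
    (h : IsKernelTransfer m κ f g) (h' : IsKernelTransfer m κ f' g') :
    IsKernelTransfer m κ (f - f') (g - g') := by
  simpa [sub_eq_add_neg] using h.add (h'.smul (-1))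

theorem IsKernelTransfer.norm_le [IsMarkovKernel κ] {f g : Lp ℝ 1 m}
    (h : IsKernelTransfer m κ f g) : ‖g‖ ≤ ‖f‖ := by
  have hg : Measurable g := (Lp.stronglyMeasurable g).measurable
  -- Testing against the sign of `g` turns the right-hand side of the duality into `‖g‖`.
  set φ : X → ℝ := fun x => if 0 ≤ g x then 1 else -1 with hφ
  have hφm : Measurable φ :=
    Measurable.ite (measurableSet_le measurable_const hg) measurable_const measurable_const
  have hφ1 : ∀ x, |φ x| ≤ 1 := fun x => by
    simp only [hφ]; split_ifs <;> simp
  have e : ∫ x, g x * φ x ∂m = ‖g‖ := by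
    rw [L1.norm_eq_integral_norm]
    congr with x
    simp only [hφ, Real.norm_eq_abs]
    split_ifs with hx
    · rw [abs_of_nonneg hx, mul_one]
    · rw [abs_of_neg (not_le.1 hx), mul_neg_one]
  rw [← e, ← h φ hφm ⟨1, hφ1⟩, L1.norm_eq_integral_norm]
  refine (Real.le_norm_self _).trans (norm_integral_le_of_norm_le (L1.integrable_coeFn f).norm ?_)
  refine ae_of_all _ fun x => ?_
  rw [norm_mul]
  exact mul_le_of_le_one_right (norm_nonneg _) (abs_integral_kernel_le hφ1 x)

/-- A transfer operator that is defined on a dense subspace extends to all of `L¹(m)`. -/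
theorem exists_transferOperator [IsMarkovKernel κ] {B : Submodule ℝ (Lp ℝ 1 m)}
    (hd : Dense (B : Set (Lp ℝ 1 m))) (hB : ∀ f : B, ∃ g, IsKernelTransfer m κ f g) :
    ∃ A : Lp ℝ 1 m →L[ℝ] Lp ℝ 1 m, ∀ f, IsKernelTransfer m κ f (A f) := by
  have htotal : ∀ f : Lp ℝ 1 m, ∃ g, IsKernelTransfer m κ f g := by
    intro f
    obtain ⟨u, huB, hu⟩ := mem_closure_iff_seq_limit.1 (hd f)
    choose v hv using fun k => hB ⟨u k, huB k⟩
    have hvc : CauchySeq v := by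
      refine Metric.cauchySeq_iff.2 fun δ hδ => ?_
      obtain ⟨N, hN⟩ := Metric.cauchySeq_iff.1 hu.cauchySeq δ hδ
      refine ⟨N, fun i hi j hj => lt_of_le_of_lt ?_ (hN i hi j hj)⟩
      rw [dist_eq_norm, dist_eq_norm]
      exact ((hv i).sub (hv j)).norm_le
    obtain ⟨g, hg⟩ := cauchySeq_tendsto_of_complete hvc
    refine ⟨g, ?_⟩
    rintro φ hφ ⟨C, hC⟩
    have h1 := ((continuous_integral_mul (m := m) (measurable_integral_kernel (κ := κ) hφ)
      (abs_integral_kernel_le hC)).tendsto f).comp hu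
    have h2 := ((continuous_integral_mul (m := m) hφ hC).tendsto g).comp hg
    refine tendsto_nhds_unique h1 (h2.congr fun k => ?_)
    exact (hv k φ hφ ⟨C, hC⟩).symm
  choose A hA using htotal
  let A' : Lp ℝ 1 m →ₗ[ℝ] Lp ℝ 1 m :=
    { toFun := A
      map_add' := fun f g => (hA (f + g)).unique ((hA f).add (hA g))
      map_smul' := fun c f => (hA (c • f)).unique ((hA f).smul c) }
  exact ⟨A'.mkContinuous 1 fun f => by rw [one_mul]; exact (hA f).norm_le, hA⟩

theorem IsTransfer.isKernelTransfer [MeasurableSingletonClass X] {T : X → X} (hT : Measurable T) {f g : Lp ℝ 1 m}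
    (h : IsTransfer m T f g) : IsKernelTransfer m (Kernel.deterministic T hT) f g := by
  intro φ hφ hC
  simpa only [Kernel.integral_deterministic hT] using h φ hφ hC

/-- For a kernel with densities, the operator `f ↦ ∫ p(x, ·) f(x) dm(x)` is the transfer operator,
by Fubini's theorem. -/
theorem IsRandomTransfer.isKernelTransfer [MeasurableSpace.CountableOrCountablyGenerated X X]
    [IsFiniteMeasure m] [IsMarkovKernel κ] (hκ : ∀ x, κ x ≪ m) {f g : Lp ℝ 1 m}
    (h : IsRandomTransfer m κ f g) : IsKernelTransfer m κ f g := by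
  rintro φ hφ ⟨C, hC⟩
  set p : X → X → ℝ := transitionDensity m κ with hp
  have hpm : Measurable (Function.uncurry p) :=
    (Kernel.measurable_rnDeriv κ (Kernel.const X m)).ennreal_toReal
  have hp0 : ∀ x y, 0 ≤ p x y := fun x y => ENNReal.toReal_nonneg
  have hdens : ∀ x, m.withDensity (κ.rnDeriv (Kernel.const X m) x) = κ x := by
    intro x
    have := Kernel.withDensity_rnDeriv_eq (κ := κ) (η := Kernel.const X m) (a := x) (hκ x)
    rwa [Kernel.withDensity_apply _ (Kernel.measurable_rnDeriv _ _)] at this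
  have hfin : ∀ x, ∀ᵐ y ∂m, κ.rnDeriv (Kernel.const X m) x y < ⊤ := by
    intro x
    refine ae_lt_top (Kernel.measurable_rnDeriv_right κ _ x) ?_
    rw [← setLIntegral_univ, ← withDensity_apply _ MeasurableSet.univ, hdens]
    simp
  have hint : ∀ (x : X) (ψ : X → ℝ), ∫ y, ψ y ∂κ x = ∫ y, p x y * ψ y ∂m := by
    intro x ψ
    conv_lhs => rw [← hdens x]
    exact integral_withDensity_eq_integral_toReal_smul
      (Kernel.measurable_rnDeriv_right κ _ x) (hfin x) ψ
  have hpint : ∀ x, Integrable (p x) m := by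
    intro x
    refine integrable_toReal_of_lintegral_ne_top
      (Kernel.measurable_rnDeriv_right κ _ x).aemeasurable ?_
    rw [← setLIntegral_univ, ← withDensity_apply _ MeasurableSet.univ, hdens]
    simp
  have hp1 : ∀ x, ∫ y, p x y ∂m = 1 := by
    intro x
    simpa using (hint x (fun _ => 1)).symm
  have hf : Measurable f := (Lp.stronglyMeasurable f).measurable
  have hF : Integrable (Function.uncurry fun x y => f x * p x y * φ y) (m.prod m) := by
    have hbase : Integrable (fun z : X × X => f z.1 * p z.1 z.2) (m.prod m) := by
      have hmeas : Measurable fun z : X × X => f z.1 * p z.1 z.2 :=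
        (hf.comp measurable_fst).mul hpm
      rw [integrable_prod_iff hmeas.aestronglyMeasurable]
      refine ⟨ae_of_all _ fun x => (hpint x).const_mul (f x), ?_⟩
      simp only [norm_mul, integral_const_mul, Real.norm_of_nonneg (hp0 _ _), hp1, mul_one]
      exact (L1.integrable_coeFn f).norm
    exact hbase.mul_bdd (c := C) (hφ.comp measurable_snd).aestronglyMeasurable
      (ae_of_all _ fun z => hC z.2)
  calc ∫ x, f x * ∫ y, φ y ∂κ x ∂m = ∫ x, ∫ y, f x * p x y * φ y ∂m ∂m := by
        congr with x
        rw [hint, ← integral_const_mul]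
        simp only [mul_assoc]
    _ = ∫ y, ∫ x, f x * p x y * φ y ∂m ∂m := integral_integral_swap hF
    _ = ∫ y, g y * φ y ∂m := by
        refine integral_congr_ae ?_
        filter_upwards [h] with y hy
        rw [hy, ← integral_mul_const]
        simp only [← hp, mul_comm]

theorem LasotaYorke.mono {B : Submodule ℝ (Lp ℝ 1 m)} {s : Seminorm ℝ B}
    {Q Q' : Lp ℝ 1 m → Lp ℝ 1 m → Prop} {η D : ℝ} (h : LasotaYorke B s Q η D)
    (hQ : ∀ f g, Q f g → Q' f g) : LasotaYorke B s Q' η D := fun f =>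
  let ⟨g, hg, hs⟩ := h f
  ⟨g, hQ _ _ hg, hs⟩

end Transfer

/-! ### Stationary densities -/

section Stationary

variable {X : Type*} [MeasurableSpace X] {m : Measure X} {κ : Kernel X X}
  {A : Lp ℝ 1 m →L[ℝ] Lp ℝ 1 m}

theorem transferOperator_nonneg (hA : ∀ f, IsKernelTransfer m κ f (A f)) {f : Lp ℝ 1 m}
    (hf : 0 ≤ f) : 0 ≤ A f := by
  rw [← Lp.coeFn_nonneg]
  refine ae_nonneg_of_forall_setIntegral_nonneg (L1.integrable_coeFn _) fun S hS _ => ?_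
  rw [(hA f).setIntegral hS]
  refine integral_nonneg_of_ae ?_
  filter_upwards [(Lp.coeFn_nonneg f).2 hf] with x hx
  exact mul_nonneg hx measureReal_nonneg

variable [IsMarkovKernel κ]

theorem integral_transferOperator (hA : ∀ f, IsKernelTransfer m κ f (A f)) (f : Lp ℝ 1 m) :
    ∫ x, A f x ∂m = ∫ x, f x ∂m := by
  simpa using (hA f).setIntegral MeasurableSet.univ

theorem integral_coeFn_sub (f g : Lp ℝ 1 m) :
    ∫ x, (f - g : Lp ℝ 1 m) x ∂m = ∫ x, f x ∂m - ∫ x, g x ∂m := by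
  rw [← integral_sub (L1.integrable_coeFn f) (L1.integrable_coeFn g)]
  exact integral_congr_ae (Lp.coeFn_sub f g)

theorem norm_eq_integral_of_nonneg {f : Lp ℝ 1 m} (hf : 0 ≤ f) : ‖f‖ = ∫ x, f x ∂m := by
  rw [L1.norm_eq_integral_norm]
  refine integral_congr_ae ?_
  filter_upwards [(Lp.coeFn_nonneg f).2 hf] with x hx
  exact Real.norm_of_nonneg hx

theorem eq_of_le_of_integral_eq {f g : Lp ℝ 1 m} (hfg : f ≤ g)
    (h : ∫ x, f x ∂m = ∫ x, g x ∂m) : f = g := by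
  have := norm_eq_integral_of_nonneg (sub_nonneg.2 hfg)
  rw [integral_coeFn_sub, h, sub_self, norm_eq_zero, sub_eq_zero] at this
  exact this.symm

/-- The positive part of a stationary function is stationary: `A d⁺ ≥ d⁺` by positivity, and both
sides have the same integral. -/
theorem transferOperator_posPart (hA : ∀ f, IsKernelTransfer m κ f (A f)) {d : Lp ℝ 1 m}
    (hd : A d = d) : A d⁺ = d⁺ := by
  refine (eq_of_le_of_integral_eq ?_ (integral_transferOperator hA d⁺).symm).symm
  refine sup_le ?_ (transferOperator_nonneg hA (posPart_nonneg d))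
  have := transferOperator_nonneg hA (sub_nonneg.2 (le_posPart d))
  rw [map_sub, hd, sub_nonneg] at this
  exact this

/-- The measure with density `h` with respect to `m`, for `h ∈ L¹(m)` nonnegative. -/
noncomputable def densityMeasure (h : Lp ℝ 1 m) : Measure X :=
  m.withDensity fun x => ENNReal.ofReal (h x)

theorem measurable_ofReal_coeFn (h : Lp ℝ 1 m) : Measurable fun x => ENNReal.ofReal (h x) :=
  (Lp.stronglyMeasurable h).measurable.ennreal_ofReal

theorem densityMeasure_apply {h : Lp ℝ 1 m} (h0 : 0 ≤ h) {S : Set X} (hS : MeasurableSet S) :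
    densityMeasure h S = ENNReal.ofReal (∫ x in S, h x ∂m) := by
  rw [densityMeasure, withDensity_apply _ hS, ofReal_integral_eq_lintegral_ofReal
    (L1.integrable_coeFn h).integrableOn (ae_restrict_of_ae ((Lp.coeFn_nonneg h).2 h0))]

theorem ae_densityMeasure_iff {h : Lp ℝ 1 m} {p : X → Prop} :
    (∀ᵐ x ∂densityMeasure h, p x) ↔ ∀ᵐ x ∂m, 0 < h x → p x := by
  rw [densityMeasure, ae_withDensity_iff (measurable_ofReal_coeFn h)]
  simp

theorem exists_densityMeasure_eq [IsFiniteMeasure m] {μ : Measure X} [IsFiniteMeasure μ]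
    (hμ : μ ≪ m) : ∃ h : Lp ℝ 1 m, 0 ≤ h ∧ densityMeasure h = μ := by
  have hi : Integrable (fun x => (μ.rnDeriv m x).toReal) m := Measure.integrable_toReal_rnDeriv
  refine ⟨hi.toL1 _, ?_, ?_⟩
  · rw [← Lp.coeFn_nonneg]
    filter_upwards [hi.coeFn_toL1] with x hx
    rw [hx]
    exact ENNReal.toReal_nonneg
  · refine (withDensity_congr_ae ?_).trans (Measure.withDensity_rnDeriv_eq μ m hμ)
    filter_upwards [hi.coeFn_toL1, Measure.rnDeriv_lt_top μ m] with x hx hx'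
    rw [hx, ENNReal.ofReal_toReal hx'.ne]

theorem setIntegral_nonneg_of_nonneg {h : Lp ℝ 1 m} (h0 : 0 ≤ h) (S : Set X) :
    0 ≤ ∫ x in S, h x ∂m :=
  integral_nonneg_of_ae (ae_restrict_of_ae ((Lp.coeFn_nonneg h).2 h0))

theorem isProbabilityMeasure_densityMeasure_iff {h : Lp ℝ 1 m} (h0 : 0 ≤ h) :
    IsProbabilityMeasure (densityMeasure h) ↔ ∫ x, h x ∂m = 1 := by
  rw [isProbabilityMeasure_iff, densityMeasure_apply h0 MeasurableSet.univ, setIntegral_univ,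
    ENNReal.ofReal_eq_one]

theorem invariant_densityMeasure_iff (hA : ∀ f, IsKernelTransfer m κ f (A f)) {h : Lp ℝ 1 m}
    (h0 : 0 ≤ h) : Kernel.Invariant κ (densityMeasure h) ↔ A h = h := by
  have key : ∀ S, MeasurableSet S →
      (densityMeasure h).bind κ S = ENNReal.ofReal (∫ x in S, A h x ∂m) := by
    intro S hS
    rw [Measure.bind_apply hS κ.aemeasurable, densityMeasure,
      lintegral_withDensity_eq_lintegral_mul _ (measurable_ofReal_coeFn h) (κ.measurable_coe hS),
      (hA h).setIntegral hS, ofReal_integral_eq_lintegral_ofReal (integrable_mul_kernel h hS)]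
    · refine lintegral_congr_ae ?_
      filter_upwards [(Lp.coeFn_nonneg h).2 h0] with x hx
      rw [Pi.mul_apply, ENNReal.ofReal_mul hx, ofReal_measureReal]
    · filter_upwards [(Lp.coeFn_nonneg h).2 h0] with x hx
      exact mul_nonneg hx measureReal_nonneg
  constructor
  · intro hinv
    refine Lp.ext (Integrable.ae_eq_of_forall_setIntegral_eq _ _ (L1.integrable_coeFn _)
      (L1.integrable_coeFn h) fun S hS _ => ?_)
    have h1 := key S hS
    rw [hinv.def, densityMeasure_apply h0 hS, ENNReal.ofReal_eq_ofReal_iff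
      (setIntegral_nonneg_of_nonneg h0 S)
      (setIntegral_nonneg_of_nonneg (transferOperator_nonneg hA h0) S)] at h1
    exact h1.symm
  · intro hfix
    refine Measure.ext fun S hS => ?_
    rw [key S hS, hfix, densityMeasure_apply h0 hS]

theorem setIntegral_compl_eq_zero_iff {h : Lp ℝ 1 m} (h0 : 0 ≤ h) {S : Set X}
    (hS : MeasurableSet S) : ∫ x in Sᶜ, h x ∂m = 0 ↔ ∀ᵐ x ∂m, 0 < h x → x ∈ S := by
  rw [integral_eq_zero_iff_of_nonneg_ae (ae_restrict_of_ae ((Lp.coeFn_nonneg h).2 h0))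
    (L1.integrable_coeFn h).integrableOn, EventuallyEq, ae_restrict_iff' hS.compl]
  refine eventually_congr ?_
  filter_upwards [(Lp.coeFn_nonneg h).2 h0] with x hx
  refine ⟨fun H hpos => by_contra fun hxS => hpos.ne' (H hxS), fun H hxS => ?_⟩
  exact le_antisymm (not_lt.1 fun hpos => hxS (H hpos)) hx

/-- If a stationary density vanishes off `S`, then the chain started in its support stays
in `S`. -/
theorem kernel_compl_eq_zero_of_stationary (hA : ∀ f, IsKernelTransfer m κ f (A f))
    {h : Lp ℝ 1 m} (h0 : 0 ≤ h) (hfix : A h = h) {S : Set X} (hS : MeasurableSet S)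
    (hhS : ∀ᵐ x ∂m, 0 < h x → x ∈ S) : ∀ᵐ x ∂m, 0 < h x → κ x Sᶜ = 0 := by
  have h1 := (hA h).setIntegral hS.compl
  have h2 := (setIntegral_compl_eq_zero_iff h0 hS).2 hhS
  have hnn : 0 ≤ᵐ[m] fun x => h x * (κ x).real Sᶜ := by
    filter_upwards [(Lp.coeFn_nonneg h).2 h0] with x hx
    exact mul_nonneg hx measureReal_nonneg
  rw [hfix, h2, eq_comm,
    integral_eq_zero_iff_of_nonneg_ae hnn (integrable_mul_kernel h hS.compl)] at h1
  filter_upwards [h1] with x hx hpos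
  rcases mul_eq_zero.1 hx with h | h
  · exact absurd h hpos.ne'
  · exact (measureReal_eq_zero_iff).1 h

/-- A set that the chain cannot leave is invariant modulo each stationary density: by conservation
of mass, it cannot be entered from its complement either. -/
theorem kernel_eq_indicator_of_stationary (hA : ∀ f, IsKernelTransfer m κ f (A f))
    {h : Lp ℝ 1 m} (h0 : 0 ≤ h) (hfix : A h = h) {S : Set X} (hS : MeasurableSet S)
    (hκS : ∀ᵐ x ∂m, x ∈ S → κ x Sᶜ = 0) :
    (fun x => κ x S) =ᵐ[densityMeasure h] S.indicator fun _ => 1 := by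
  have h1 := (hA h).setIntegral hS
  rw [hfix, ← integral_add_compl hS (integrable_mul_kernel h hS)] at h1
  have h2 : ∫ x in S, h x * (κ x).real S ∂m = ∫ x in S, h x ∂m := by
    refine integral_congr_ae ?_
    filter_upwards [ae_restrict_of_ae hκS, ae_restrict_mem hS] with x hx hxS
    rw [measureReal_def, (prob_compl_eq_zero_iff hS).1 (hx hxS), ENNReal.toReal_one, mul_one]
  rw [h2, left_eq_add] at h1
  have hnn : 0 ≤ᵐ[m.restrict Sᶜ] fun x => h x * (κ x).real S := by
    filter_upwards [ae_restrict_of_ae ((Lp.coeFn_nonneg h).2 h0)] with x hx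
    exact mul_nonneg hx measureReal_nonneg
  rw [integral_eq_zero_iff_of_nonneg_ae hnn (integrable_mul_kernel h hS).integrableOn] at h1
  refine ae_densityMeasure_iff.2 ?_
  filter_upwards [hκS, (ae_restrict_iff' hS.compl).1 h1] with x hx hx' hpos
  by_cases hxS : x ∈ S
  · rw [Set.indicator_of_mem hxS]
    exact (prob_compl_eq_zero_iff hS).1 (hx hxS)
  · rw [Set.indicator_of_notMem hxS]
    rcases mul_eq_zero.1 (hx' hxS) with h | h
    · exact absurd h hpos.ne'
    · exact (measureReal_eq_zero_iff).1 h

/-- The restriction of a stationary density to an invariant set is stationary. -/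
theorem exists_stationary_restrict (hA : ∀ f, IsKernelTransfer m κ f (A f))
    {h : Lp ℝ 1 m} (h0 : 0 ≤ h) (hfix : A h = h) {S : Set X} (hS : MeasurableSet S)
    (hκS : (fun x => κ x S) =ᵐ[densityMeasure h] S.indicator fun _ => 1) :
    ∃ g : Lp ℝ 1 m, A g = g ∧ g =ᵐ[m] S.indicator h := by
  have hi : Integrable (S.indicator h) m := (L1.integrable_coeFn h).indicator hS
  refine ⟨hi.toL1 _, ?_, hi.coeFn_toL1⟩
  refine Lp.ext (Integrable.ae_eq_of_forall_setIntegral_eq _ _ (L1.integrable_coeFn _)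
    (L1.integrable_coeFn _) fun R hR _ => ?_)
  have h1 : ∫ x in R, hi.toL1 _ x ∂m = ∫ x in R ∩ S, h x ∂m := by
    rw [setIntegral_congr_ae hR (hi.coeFn_toL1.mono fun x hx _ => hx), setIntegral_indicator hS]
  rw [(hA _).setIntegral hR, h1]
  have h2 := (hA h).setIntegral (hR.inter hS)
  rw [hfix] at h2
  rw [h2]
  refine integral_congr_ae ?_
  filter_upwards [hi.coeFn_toL1, ae_densityMeasure_iff.1 hκS, (Lp.coeFn_nonneg h).2 h0]
    with x hx hxS hx0
  rw [hx]
  rcases hx0.eq_or_lt with hz | hpos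
  · have hz : h x = 0 := hz.symm
    by_cases hxS : x ∈ S <;> simp [hxS, hz]
  · have hxS := hxS hpos
    by_cases hxS' : x ∈ S
    · rw [Set.indicator_of_mem hxS'] at hxS ⊢
      rw [measureReal_def, measureReal_def,
        measure_inter_conull' (measure_mono_null (Set.sdiff_subset_compl _ _)
          ((prob_compl_eq_zero_iff hS).2 hxS))]
    · rw [Set.indicator_of_notMem hxS'] at hxS ⊢
      rw [measureReal_def (s := R ∩ S), measure_mono_null Set.inter_subset_right hxS]
      simp

end Stationary

/-! ### Ergodic stationary measures -/

section Ergodic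

variable {X : Type*} [MeasurableSpace X] {m : Measure X} {κ : Kernel X X}
  {A : Lp ℝ 1 m →L[ℝ] Lp ℝ 1 m}

theorem setIntegral_smul_add_smul (a b : ℝ) (f g : Lp ℝ 1 m) (S : Set X) :
    ∫ x in S, (a • f + b • g : Lp ℝ 1 m) x ∂m = a * ∫ x in S, f x ∂m + b * ∫ x in S, g x ∂m := by
  rw [← integral_const_mul, ← integral_const_mul,
    ← integral_add ((L1.integrable_coeFn f).integrableOn.const_mul a)
      ((L1.integrable_coeFn g).integrableOn.const_mul b)]
  refine integral_congr_ae (ae_restrict_of_ae ?_)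
  filter_upwards [Lp.coeFn_add (a • f) (b • g), Lp.coeFn_smul a f, Lp.coeFn_smul b g]
    with x h1 h2 h3
  rw [h1, Pi.add_apply, h2, h3, Pi.smul_apply, Pi.smul_apply, smul_eq_mul, smul_eq_mul]

theorem coeFn_smul_nonneg {c : ℝ} (hc : 0 ≤ c) {f : Lp ℝ 1 m} (hf : 0 ≤ f) : 0 ≤ c • f := by
  rw [← Lp.coeFn_nonneg] at hf ⊢
  filter_upwards [hf, Lp.coeFn_smul c f] with x hx hx'
  rw [hx']
  exact mul_nonneg hc hx

/-- The probability densities that vanish off `W`. -/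
def probabilityDensities (m : Measure X) (W : Set X) : Set (Lp ℝ 1 m) :=
  {h | 0 ≤ h ∧ ∫ x, h x ∂m = 1 ∧ ∫ x in Wᶜ, h x ∂m = 0}

theorem convex_probabilityDensities (W : Set X) : Convex ℝ (probabilityDensities m W) := by
  rintro f ⟨hf0, hf1, hfW⟩ g ⟨hg0, hg1, hgW⟩ a b ha hb hab
  refine ⟨add_nonneg (coeFn_smul_nonneg ha hf0) (coeFn_smul_nonneg hb hg0), ?_, ?_⟩
  · have := setIntegral_smul_add_smul a b f g Set.univ
    simp only [setIntegral_univ] at this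
    rw [this, hf1, hg1, mul_one, mul_one, hab]
  · rw [setIntegral_smul_add_smul, hfW, hgW, mul_zero, mul_zero, add_zero]

theorem isClosed_probabilityDensities (W : Set X) : IsClosed (probabilityDensities m W) := by
  have h0 : IsClosed {h : Lp ℝ 1 m | 0 ≤ h} := isClosed_le continuous_const continuous_id
  have h1 : IsClosed {h : Lp ℝ 1 m | ∫ x, h x ∂m = 1} :=
    isClosed_eq continuous_integral continuous_const
  have h2 : IsClosed {h : Lp ℝ 1 m | ∫ x in Wᶜ, h x ∂m = 0} :=
    isClosed_eq (continuous_setIntegral _) continuous_const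
  exact h0.inter (h1.inter h2)

theorem probabilityDensities_nonempty [IsFiniteMeasure m] {W : Set X} (hW : MeasurableSet W)
    (hmW : m W ≠ 0) : (probabilityDensities m W).Nonempty := by
  have hr : 0 < m.real W := ENNReal.toReal_pos hmW (measure_ne_top m W)
  set f : X → ℝ := W.indicator fun _ => (m.real W)⁻¹ with hf
  have hi : Integrable f m := (integrable_const _).indicator hW
  refine ⟨hi.toL1 f, ?_, ?_, ?_⟩
  · rw [← Lp.coeFn_nonneg]
    filter_upwards [hi.coeFn_toL1] with x hx
    rw [hx]
    exact Set.indicator_nonneg (fun _ _ => by positivity) x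
  · rw [integral_congr_ae hi.coeFn_toL1, hf, integral_indicator hW, setIntegral_const,
      smul_eq_mul, mul_inv_cancel₀ hr.ne']
  · rw [integral_congr_ae (ae_restrict_of_ae hi.coeFn_toL1), hf, setIntegral_indicator hW]
    simp

theorem norm_eq_one_of_mem_probabilityDensities {W : Set X} {h : Lp ℝ 1 m}
    (hh : h ∈ probabilityDensities m W) : ‖h‖ = 1 :=
  (norm_eq_integral_of_nonneg hh.1).trans hh.2.1

variable [IsMarkovKernel κ]

/-- If the chain cannot leave `W`, then the transfer operator preserves the densities that
vanish off `W`. -/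
theorem mapsTo_probabilityDensities (hA : ∀ f, IsKernelTransfer m κ f (A f)) {W : Set X}
    (hW : MeasurableSet W) (hκW : ∀ᵐ x ∂m, x ∈ W → κ x Wᶜ = 0) :
    Set.MapsTo A (probabilityDensities m W) (probabilityDensities m W) := by
  rintro h ⟨h0, h1, hhW⟩
  refine ⟨transferOperator_nonneg hA h0, (integral_transferOperator hA h).trans h1, ?_⟩
  rw [(hA h).setIntegral hW.compl]
  refine integral_eq_zero_of_ae ?_
  filter_upwards [(setIntegral_compl_eq_zero_iff h0 hW).1 hhW, hκW, (Lp.coeFn_nonneg h).2 h0]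
    with x hx hκx hx0
  rcases hx0.eq_or_lt with hz | hpos
  · rw [← hz]; simp
  · simp [measureReal_def, hκx (hx hpos)]

theorem isAcsm_densityMeasure (hA : ∀ f, IsKernelTransfer m κ f (A f)) {h : Lp ℝ 1 m}
    (h0 : 0 ≤ h) (h1 : ∫ x, h x ∂m = 1) (hfix : A h = h) : IsAcsm m κ (densityMeasure h) :=
  ⟨(isProbabilityMeasure_densityMeasure_iff h0).2 h1, withDensity_absolutelyContinuous _ _,
    (invariant_densityMeasure_iff hA h0).2 hfix⟩

theorem IsAcsm.exists_density [IsFiniteMeasure m] (hA : ∀ f, IsKernelTransfer m κ f (A f))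
    {μ : Measure X} (hμ : IsAcsm m κ μ) :
    ∃ h : Lp ℝ 1 m, 0 ≤ h ∧ ∫ x, h x ∂m = 1 ∧ A h = h ∧ densityMeasure h = μ := by
  obtain ⟨hp, hac, hinv⟩ := hμ
  obtain ⟨h, h0, rfl⟩ := exists_densityMeasure_eq hac
  exact ⟨h, h0, (isProbabilityMeasure_densityMeasure_iff h0).1 hp,
    (invariant_densityMeasure_iff hA h0).1 hinv, rfl⟩

/-- A density that is an extreme point of the stationary densities supported in `W` is ergodic: an
invariant set of intermediate measure would split it into a proper convex combination. -/
theorem isErgodicAcsm_of_mem_extremePoints (hA : ∀ f, IsKernelTransfer m κ f (A f)) {W : Set X}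
    (hW : MeasurableSet W) {h : Lp ℝ 1 m}
    (hext : h ∈ ({h | A h = h} ∩ probabilityDensities m W).extremePoints ℝ) :
    IsErgodicAcsm m κ (densityMeasure h) := by
  obtain ⟨⟨hfix, h0, h1, hhW⟩, hsplit⟩ := mem_extremePoints.1 hext
  replace hfix : A h = h := hfix
  refine ⟨isAcsm_densityMeasure hA h0 h1 hfix, fun S hS hκS => ?_⟩
  obtain ⟨g, hg, hgS⟩ := exists_stationary_restrict hA h0 hfix hS hκS
  rw [densityMeasure_apply h0 hS]
  set t : ℝ := ∫ x in S, h x ∂m with ht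
  have ht0 : 0 ≤ t := setIntegral_nonneg_of_nonneg h0 S
  have hcompl : t + ∫ x in Sᶜ, h x ∂m = 1 := by
    rw [ht, integral_add_compl hS (L1.integrable_coeFn h), h1]
  have ht1 : t ≤ 1 := by
    have := setIntegral_nonneg_of_nonneg h0 Sᶜ
    linarith
  by_contra hcon
  rw [not_or, ENNReal.ofReal_eq_zero, not_le, ENNReal.ofReal_eq_one] at hcon
  obtain ⟨htpos, htne⟩ := hcon
  have htlt : t < 1 := lt_of_le_of_ne ht1 htne
  have hg0 : 0 ≤ g := by
    rw [← Lp.coeFn_nonneg]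
    filter_upwards [hgS, (Lp.coeFn_nonneg h).2 h0] with x hx hx0
    rw [hx]
    exact Set.indicator_nonneg (fun _ _ => hx0) x
  have hgh : g ≤ h := by
    rw [← Lp.coeFn_le]
    filter_upwards [hgS, (Lp.coeFn_nonneg h).2 h0] with x hx hx0
    rw [hx]
    exact Set.indicator_apply_le' (fun _ => le_rfl) fun _ => hx0
  have hgint : ∀ R, ∫ x in R, g x ∂m = ∫ x in R ∩ S, h x ∂m := fun R => by
    rw [integral_congr_ae (ae_restrict_of_ae hgS), setIntegral_indicator hS]
  have hg1 : ∫ x, g x ∂m = t := by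
    have := hgint Set.univ
    rwa [setIntegral_univ, Set.univ_inter] at this
  have hgW : ∫ x in Wᶜ, g x ∂m = 0 := by
    rw [setIntegral_compl_eq_zero_iff hg0 hW]
    filter_upwards [(setIntegral_compl_eq_zero_iff h0 hW).1 hhW, (Lp.coeFn_le g h).2 hgh]
      with x hx hx' hpos
    exact hx (hpos.trans_le hx')
  have hmem1 : t⁻¹ • g ∈ {h | A h = h} ∩ probabilityDensities m W := by
    refine ⟨by simp [hg], coeFn_smul_nonneg (by positivity) hg0, ?_, ?_⟩
    · have := setIntegral_smul_add_smul t⁻¹ 0 g g Set.univ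
      simp only [zero_smul, add_zero, setIntegral_univ, zero_mul, hg1] at this
      rw [this, inv_mul_cancel₀ htpos.ne']
    · have := setIntegral_smul_add_smul t⁻¹ 0 g g Wᶜ
      simpa [hgW] using this
  have hsub : 0 < 1 - t := by linarith
  have hmem2 : (1 - t)⁻¹ • (h - g) ∈ {h | A h = h} ∩ probabilityDensities m W := by
    refine ⟨by simp [hg, hfix], coeFn_smul_nonneg (by positivity) (sub_nonneg.2 hgh), ?_, ?_⟩
    · have := setIntegral_smul_add_smul (1 - t)⁻¹ (-(1 - t)⁻¹) h g Set.univ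
      rw [neg_smul, ← sub_eq_add_neg, ← smul_sub] at this
      simp only [setIntegral_univ, hg1, h1] at this
      rw [this]
      field_simp
      ring
    · have := setIntegral_smul_add_smul (1 - t)⁻¹ (-(1 - t)⁻¹) h g Wᶜ
      rw [neg_smul, ← sub_eq_add_neg, ← smul_sub] at this
      rw [this, hgW, hhW]
      simp
  obtain ⟨heq, -⟩ := hsplit _ hmem1 _ hmem2 ⟨t, 1 - t, htpos, hsub, by ring, by
    rw [smul_smul, smul_smul, mul_inv_cancel₀ htpos.ne', mul_inv_cancel₀ hsub.ne']
    simp⟩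
  have := setIntegral_smul_add_smul t⁻¹ 0 g g S
  simp only [zero_smul, add_zero, zero_mul, hgint, Set.inter_self, ← ht, heq] at this
  rw [inv_mul_cancel₀ htpos.ne'] at this
  exact htne this

/-- Each set that the chain cannot leave carries an ergodic absolutely continuous stationary
measure, namely an extreme point (Krein-Milman) of the compact convex set of stationary densities
supported in it. -/
theorem exists_isErgodicAcsm_of_invariant [IsFiniteMeasure m]
    (hA : ∀ f, IsKernelTransfer m κ f (A f))
    (hcomp : IsCompact {h | A h = h ∧ ‖h‖ ≤ 1})
    (hfixed : ∀ C : Set (Lp ℝ 1 m), Convex ℝ C → IsClosed C → Set.MapsTo A C C → C.Nonempty →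
      ∃ h ∈ C, A h = h)
    {W : Set X} (hW : MeasurableSet W) (hmW : m W ≠ 0) (hκW : ∀ᵐ x ∂m, x ∈ W → κ x Wᶜ = 0) :
    ∃ ν, IsErgodicAcsm m κ ν ∧ ν Wᶜ = 0 := by
  obtain ⟨h, hh, hfix⟩ := hfixed _ (convex_probabilityDensities W)
    (isClosed_probabilityDensities W) (mapsTo_probabilityDensities hA hW hκW)
    (probabilityDensities_nonempty hW hmW)
  have hK : IsCompact ({h | A h = h} ∩ probabilityDensities m W) :=
    hcomp.of_isClosed_subset
      ((isClosed_eq A.continuous continuous_id).inter (isClosed_probabilityDensities W))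
      fun f hf => ⟨hf.1, (norm_eq_one_of_mem_probabilityDensities hf.2).le⟩
  obtain ⟨g, hg⟩ := hK.extremePoints_nonempty ⟨h, hfix, hh⟩
  refine ⟨densityMeasure g, isErgodicAcsm_of_mem_extremePoints hA hW hg, ?_⟩
  obtain ⟨-, g0, -, hgW⟩ := hg.1
  rw [densityMeasure_apply g0 hW.compl, hgW, ENNReal.ofReal_zero]

theorem ae_pos_posPart_iff (d : Lp ℝ 1 m) : ∀ᵐ x ∂m, (0 < (d⁺ : Lp ℝ 1 m) x ↔ 0 < d x) := by
  filter_upwards [Lp.coeFn_sup d 0, Lp.coeFn_zero ℝ 1 m] with x hx hx0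
  change 0 < (d ⊔ 0 : Lp ℝ 1 m) x ↔ _
  rw [hx, Pi.sup_apply, hx0]
  simp

/-- If `h` is the density of an ergodic stationary measure and `k ≠ h` is another stationary
density, then `k < h` holds almost everywhere on the support of `h`. -/
theorem ae_lt_of_ergodic (hA : ∀ f, IsKernelTransfer m κ f (A f)) {h k : Lp ℝ 1 m}
    (h0 : 0 ≤ h) (k0 : 0 ≤ k) (h1 : ∫ x, h x ∂m = 1) (k1 : ∫ x, k x ∂m = 1)
    (hfix : A h = h) (kfix : A k = k) (herg : IsErgodicAcsm m κ (densityMeasure h))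
    (hne : h ≠ k) : ∀ᵐ x ∂m, 0 < h x → k x < h x := by
  have hmeas : MeasurableSet {x | k x < h x} :=
    measurableSet_lt (Lp.stronglyMeasurable k).measurable (Lp.stronglyMeasurable h).measurable
  have hd : A (h - k)⁺ = (h - k)⁺ := transferOperator_posPart hA (by rw [map_sub, hfix, kfix])
  have hpos : ∀ᵐ x ∂m, 0 < ((h - k)⁺ : Lp ℝ 1 m) x ↔ k x < h x := by
    filter_upwards [ae_pos_posPart_iff (h - k), Lp.coeFn_sub h k] with x hx hx'
    rw [hx, hx', Pi.sub_apply, sub_pos]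
  have hκ : ∀ᵐ x ∂m, x ∈ {x | k x < h x} → κ x {x | k x < h x}ᶜ = 0 := by
    filter_upwards [hpos, kernel_compl_eq_zero_of_stationary hA (posPart_nonneg _) hd hmeas
      (hpos.mono fun x hx => hx.1)] with x hx hx' hxS
    exact hx' (hx.2 hxS)
  have hp : IsProbabilityMeasure (densityMeasure h) := herg.isAcsm.isProbabilityMeasure
  rcases herg.ergodic _ hmeas (kernel_eq_indicator_of_stationary hA h0 hfix hmeas hκ)
    with hz | ho
  · -- The set `{k < h}` lies in the support of `h`, so it can only be null if `h = k`.
    refine absurd (eq_of_le_of_integral_eq ?_ (h1.trans k1.symm)) hne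
    rw [← Lp.coeFn_le]
    have hz' : ∀ᵐ x ∂densityMeasure h, ¬ k x < h x := measure_eq_zero_iff_ae_notMem.1 hz
    filter_upwards [ae_densityMeasure_iff.1 hz', (Lp.coeFn_nonneg k).2 k0] with x hx hk0
    by_contra hlt
    rw [not_le] at hlt
    exact hx (lt_of_le_of_lt hk0 hlt) hlt
  · have ho' : ∀ᵐ x ∂densityMeasure h, x ∈ {x | k x < h x} :=
      (prob_compl_eq_zero_iff hmeas).2 ho
    exact ae_densityMeasure_iff.1 ho'

/-- Distinct ergodic stationary densities have disjoint supports. -/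
theorem ae_disjoint_of_ergodic (hA : ∀ f, IsKernelTransfer m κ f (A f)) {h k : Lp ℝ 1 m}
    (h0 : 0 ≤ h) (k0 : 0 ≤ k) (h1 : ∫ x, h x ∂m = 1) (k1 : ∫ x, k x ∂m = 1)
    (hfix : A h = h) (kfix : A k = k) (herg : IsErgodicAcsm m κ (densityMeasure h))
    (kerg : IsErgodicAcsm m κ (densityMeasure k)) (hne : h ≠ k) :
    ∀ᵐ x ∂m, ¬ (0 < h x ∧ 0 < k x) := by
  filter_upwards [ae_lt_of_ergodic hA h0 k0 h1 k1 hfix kfix herg hne,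
    ae_lt_of_ergodic hA k0 h0 k1 h1 kfix hfix kerg hne.symm] with x hx hx' hpos
  exact lt_asymm (hx hpos.1) (hx' hpos.2)

/-- There are finitely many ergodic absolutely continuous stationary measures, since their
densities have pairwise distance `2` and lie in a compact set. -/
theorem finite_isErgodicAcsm [IsFiniteMeasure m] (hA : ∀ f, IsKernelTransfer m κ f (A f))
    (hcomp : IsCompact {h | A h = h ∧ ‖h‖ ≤ 1}) : {μ | IsErgodicAcsm m κ μ}.Finite := by
  obtain ⟨t, -, htfin, htcover⟩ := hcomp.finite_cover_balls one_pos
  have hex : ∀ μ, IsErgodicAcsm m κ μ → ∃ c ∈ t, ∃ h : Lp ℝ 1 m,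
      (0 ≤ h ∧ ∫ x, h x ∂m = 1 ∧ A h = h ∧ densityMeasure h = μ) ∧ dist h c < 1 := by
    intro μ hμ
    obtain ⟨h, hh⟩ := hμ.isAcsm.exists_density hA
    obtain ⟨c, hc, hhc⟩ := Set.mem_iUnion₂.1
      (htcover ⟨hh.2.2.1, ((norm_eq_integral_of_nonneg hh.1).trans hh.2.1).le⟩)
    exact ⟨c, hc, h, hh, hhc⟩
  choose! c hct h hh hhc using hex
  refine Set.Finite.of_injOn (f := c) (fun μ hμ => hct μ hμ) ?_ htfin
  intro μ hμ ν hν hc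
  obtain ⟨h0, h1, hfix, hμ'⟩ := hh μ hμ
  obtain ⟨k0, k1, kfix, hν'⟩ := hh ν hν
  by_contra hne
  have hne' : h μ ≠ h ν := fun h => hne (by rw [← hμ', ← hν', h])
  have hdisj := ae_disjoint_of_ergodic hA h0 k0 h1 k1 hfix kfix (hμ'.symm ▸ hμ) (hν'.symm ▸ hν)
    hne'
  have hdist : dist (h μ) (h ν) = 2 := by
    rw [dist_eq_norm, L1.norm_eq_integral_norm]
    have : ∫ x, ‖(h μ - h ν : Lp ℝ 1 m) x‖ ∂m = ∫ x, (h μ x + h ν x) ∂m := by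
      refine integral_congr_ae ?_
      filter_upwards [hdisj, Lp.coeFn_sub (h μ) (h ν), (Lp.coeFn_nonneg _).2 h0,
        (Lp.coeFn_nonneg _).2 k0] with x hx hsub hx0 hk0
      rw [hsub, Pi.sub_apply, Real.norm_eq_abs]
      rcases hx0.eq_or_lt with hz | hpos
      · have hz : h μ x = 0 := hz.symm
        rw [hz, zero_sub, abs_neg, zero_add, abs_of_nonneg hk0]
      · have hz : h ν x = 0 := le_antisymm (not_lt.1 fun hk => hx ⟨hpos, hk⟩) hk0
        rw [hz, sub_zero, add_zero, abs_of_pos hpos]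
    rw [this, integral_add (L1.integrable_coeFn _) (L1.integrable_coeFn _), h1, k1]
    norm_num
  have h3 := dist_triangle_right (h μ) (h ν) (c μ)
  have h4 := hhc μ hμ
  have h5 := hhc ν hν
  rw [← hc] at h5
  linarith

/-- Distinct stationary densities give rise to nonzero stationary functions with disjoint supports,
the positive and negative parts of their difference. -/
theorem exists_disjoint_stationary (hA : ∀ f, IsKernelTransfer m κ f (A f)) {h k : Lp ℝ 1 m}
    (h1 : ∫ x, h x ∂m = 1) (k1 : ∫ x, k x ∂m = 1) (hfix : A h = h) (kfix : A k = k)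
    (hne : h ≠ k) : ∃ f g : Lp ℝ 1 m, 0 ≤ f ∧ 0 ≤ g ∧ f ≠ 0 ∧ g ≠ 0 ∧ A f = f ∧ A g = g ∧
      ∀ᵐ x ∂m, ¬ (0 < f x ∧ 0 < g x) := by
  have hpos : ∀ {h k : Lp ℝ 1 m}, ∫ x, h x ∂m = 1 → ∫ x, k x ∂m = 1 → h ≠ k →
      (h - k)⁺ ≠ 0 := by
    intro h k h1 k1 hne hz
    exact hne (eq_of_le_of_integral_eq (sub_nonpos.1 (posPart_eq_zero.1 hz)) (h1.trans k1.symm))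
  refine ⟨(h - k)⁺, (k - h)⁺, posPart_nonneg _, posPart_nonneg _, hpos h1 k1 hne,
    hpos k1 h1 hne.symm, transferOperator_posPart hA (by rw [map_sub, hfix, kfix]),
    transferOperator_posPart hA (by rw [map_sub, hfix, kfix]), ?_⟩
  filter_upwards [ae_pos_posPart_iff (h - k), ae_pos_posPart_iff (k - h), Lp.coeFn_sub h k,
    Lp.coeFn_sub k h] with x h1 h2 h3 h4
  rw [h1, h2, h3, h4, Pi.sub_apply, Pi.sub_apply]
  rintro ⟨h5, h6⟩
  linarith

/-- The acims of a map are the acsms of the corresponding deterministic kernel. -/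
theorem isAcim_iff_isAcsm_deterministic {T : X → X} (hT : Measurable T) {μ : Measure X} :
    IsAcim m T μ ↔ IsAcsm m (Kernel.deterministic T hT) μ := by
  have : MeasurePreserving T μ μ ↔ Kernel.Invariant (Kernel.deterministic T hT) μ := by
    rw [Kernel.Invariant, Measure.deterministic_comp_eq_map hT]
    exact ⟨fun h => h.map_eq, fun h => ⟨hT, h⟩⟩
  exact ⟨fun h => ⟨h.1, h.2, this.1 h.3⟩, fun h => ⟨h.1, h.2, this.2 h.3⟩⟩

theorem isErgodicAcim_iff_isErgodicAcsm_deterministic {T : X → X} (hT : Measurable T)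
    {μ : Measure X} :
    IsErgodicAcim m T μ ↔ IsErgodicAcsm m (Kernel.deterministic T hT) μ := by
  have hind : ∀ {S : Set X}, MeasurableSet S → ∀ x,
      Kernel.deterministic T hT x S = S.indicator (fun _ => 1) (T x) := fun hS x => by
    rw [Kernel.deterministic_apply' hT x hS]
  constructor
  · rintro ⟨hacim, herg⟩
    refine ⟨(isAcim_iff_isAcsm_deterministic hT).1 hacim, fun S hS hκ => ?_⟩
    have hp := hacim.isProbabilityMeasure
    have hTS : T ⁻¹' S =ᵐ[μ] S := by
      filter_upwards [hκ] with x hx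
      rw [hind hS] at hx
      refine propext ?_
      change T x ∈ S ↔ x ∈ S
      by_cases h1 : T x ∈ S <;> by_cases h2 : x ∈ S <;> simp_all
    rcases herg.quasiErgodic.ae_empty_or_univ₀ hS.nullMeasurableSet hTS with h | h
    · exact Or.inl (by rw [measure_congr h, measure_empty])
    · exact Or.inr (by rw [measure_congr h, measure_univ])
  · rintro ⟨hacsm, herg⟩
    have hacim := (isAcim_iff_isAcsm_deterministic hT).2 hacsm
    have hp := hacim.isProbabilityMeasure
    refine ⟨hacim, { hacim.invariant with aeconst_set := fun S hS hTS => ?_ }⟩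
    have hκ : ∀ x, Kernel.deterministic T hT x S = S.indicator (fun _ => 1) x := fun x => by
      have hx : T x ∈ S ↔ x ∈ S := Set.ext_iff.1 hTS x
      rw [hind hS]
      by_cases h : x ∈ S <;> simp [hx, h]
    rw [eventuallyConst_set']
    rcases herg S hS (ae_of_all _ hκ) with h | h
    · exact Or.inl (ae_eq_empty.2 h)
    · exact Or.inr (ae_eq_univ.2 ((prob_compl_eq_zero_iff hS).2 h))

end Ergodic

/-! ### From supports of stationary densities to forward invariant sets -/

section Topological

theorem disjoint_interior_closure {X : Type*} [TopologicalSpace X] {U V : Set X}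
    (hV : IsOpen V) (h : Disjoint U V) :
    Disjoint (interior (closure U)) (interior (closure V)) :=
  (((h.closure_left hV).mono_left interior_subset).closure_right isOpen_interior).mono_right
    interior_subset

variable {X : Type*} [MeasurableSpace X] {m : Measure X}

theorem exists_isOpen_ae_eq_support [TopologicalSpace X] (h : Lp ℝ 1 m) {h' : X → ℝ}
    (hh' : h =ᵐ[m] h') (hcont : m {x | ¬ ContinuousAt h' x} = 0) :
    ∃ U : Set X, IsOpen U ∧ ∀ᵐ x ∂m, x ∈ U ↔ 0 < h x := by
  refine ⟨interior {x | 0 < h' x}, isOpen_interior, ?_⟩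
  filter_upwards [hh', measure_eq_zero_iff_ae_notMem.1 hcont] with x hx hc
  rw [hx]
  refine ⟨fun hU => interior_subset (s := {x | 0 < h' x}) hU, fun hpos => ?_⟩
  exact mem_interior_iff_mem_nhds.2 ((not_not.1 hc).eventually_const_lt hpos)

/-- If the chain cannot leave the open set `U`, then almost every orbit of `T` that starts in
`interior (closure U)` stays there: for almost every `x ∈ U` the ball of radius `ε` around `T x` is
contained in `closure U`, and by continuity the images of nearby points lie in that ball. It is not
claimed that `T` maps `U` to itself, as `κ x` need not charge all of the ball. -/
theorem ae_mem_interior_closure [PseudoMetricSpace X] [m.IsOpenPosMeasure] {κ : Kernel X X}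
    {T : X → X} (hT : m {x | ¬ ContinuousAt T x} = 0) {ε : ℝ} (hε : 0 < ε)
    (hsupp : ∀ x, (κ x).support = closure (Metric.ball (T x) ε)) {U : Set X} (hU : IsOpen U)
    (hκU : ∀ᵐ x ∂m, x ∈ U → κ x Uᶜ = 0) :
    ∀ᵐ x ∂m, x ∈ interior (closure U) → T x ∈ interior (closure U) := by
  have hball : ∀ x, κ x Uᶜ = 0 → Metric.ball (T x) ε ⊆ interior (closure U) := by
    intro x hx
    refine interior_maximal (subset_closure.trans ?_) Metric.isOpen_ball
    rw [← hsupp x]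
    refine Measure.support_subset_of_isClosed isClosed_closure ?_
    exact measure_mono_null (Set.compl_subset_compl.2 subset_closure) hx
  filter_upwards [measure_eq_zero_iff_ae_notMem.1 hT] with x hx hxW
  have hnhds : {y | dist (T y) (T x) < ε} ∈ 𝓝 x :=
    (not_not.1 hx).eventually (Metric.ball_mem_nhds (T x) hε)
  obtain ⟨O, hO, hOo, hxO⟩ := mem_nhds_iff.1 hnhds
  have hne : (O ∩ U).Nonempty := mem_closure_iff.1 (interior_subset hxW) O hOo hxO
  have hpos : m (O ∩ U) ≠ 0 := ((hOo.inter hU).measure_pos m hne).ne'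
  obtain ⟨y, ⟨hyO, hyU⟩, hy⟩ :=
    (frequently_ae_mem_iff.2 hpos).and_eventually hκU |>.exists
  refine hball y (hy hyU) ?_
  rw [Metric.mem_ball, dist_comm]
  exact hO hyO

end Topological

/-! ### Comparison of the random and the deterministic system -/

section Comparison

variable {X : Type*} [MeasurableSpace X] {m : Measure X}

theorem exists_transferOperator_of_lasotaYorke [TopologicalSpace X] {κ : Kernel X X}
    [IsMarkovKernel κ] {B : Submodule ℝ (Lp ℝ 1 m)} {s : Seminorm ℝ B} (hB : IsAdaptedSpace B s)
    {η D : ℝ} (hη1 : η < 1) (hD : 0 ≤ D) (hLY : LasotaYorke B s (IsKernelTransfer m κ) η D) :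
    ∃ A : Lp ℝ 1 m →L[ℝ] Lp ℝ 1 m, (∀ f, IsKernelTransfer m κ f (A f)) ∧
      IsCompact {h | A h = h ∧ ‖h‖ ≤ 1} ∧
      ∀ C : Set (Lp ℝ 1 m), Convex ℝ C → IsClosed C → Set.MapsTo A C C → C.Nonempty →
        ∃ h : B, (h : Lp ℝ 1 m) ∈ C ∧ A h = h := by
  obtain ⟨A, hA⟩ := exists_transferOperator (κ := κ) hB.dense fun f =>
    let ⟨g, hg, _⟩ := hLY f
    ⟨g, hg⟩
  have hLY' : ∀ f : B, ∃ g : B, (g : Lp ℝ 1 m) = A f ∧ s g ≤ η * s f + D * ‖(f : Lp ℝ 1 m)‖ :=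
    fun f =>
      let ⟨g, hg, hs⟩ := hLY f
      ⟨g, hg.unique (hA f), hs⟩
  have hnorm : ∀ f, ‖A f‖ ≤ ‖f‖ := fun f => (hA f).norm_le
  refine ⟨A, hA, isCompact_fixedPoints_of_lasotaYorke hB.dense hB.compact_unitBall hnorm hη1 hD
    hLY', fun C hconv hcl hmaps hne => ?_⟩
  obtain ⟨h, hhC, hfix, -⟩ := exists_fixedPoint_of_lasotaYorke hB.dense hB.compact_unitBall hnorm
    hη1 hD hLY' hconv hcl hmaps hne
  exact ⟨h, hhC, hfix⟩

/-- Measures that live on the regularized supports of disjoint densities are distinct. -/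
theorem ne_of_ae_disjoint [TopologicalSpace X] [m.IsOpenPosMeasure] {h k : Lp ℝ 1 m}
    {U V : Set X} (hU : IsOpen U) (hV : IsOpen V) (hUh : ∀ᵐ x ∂m, x ∈ U ↔ 0 < h x)
    (hVk : ∀ᵐ x ∂m, x ∈ V ↔ 0 < k x) (hdisj : ∀ᵐ x ∂m, ¬ (0 < h x ∧ 0 < k x))
    {μ ν : Measure X} [IsProbabilityMeasure μ] (hμ : μ (interior (closure U))ᶜ = 0)
    (hν : ν (interior (closure V))ᶜ = 0) : μ ≠ ν := by
  rintro rfl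
  have hUV : m (U ∩ V) = 0 := by
    rw [measure_eq_zero_iff_ae_notMem]
    filter_upwards [hUh, hVk, hdisj] with x h1 h2 h3 h4
    exact h3 ⟨h1.1 h4.1, h2.1 h4.2⟩
  have hUV' : Disjoint U V :=
    Set.disjoint_iff_inter_eq_empty.2 (((hU.inter hV).measure_eq_zero_iff m).1 hUV)
  have hempty := (disjoint_interior_closure hV hUV').inter_eq
  have : μ Set.univ = 0 := by
    rw [← Set.compl_empty, ← hempty, Set.compl_inter]
    exact measure_union_null hμ hν
  simp at this

/-- The comparison for a single chain whose noise has full support in the `ε`-balls. Distinct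
ergodic acsms have disjoint open supports, each of which gives rise to a forward invariant set of
`T` and thus to an ergodic acim. -/
theorem encard_isErgodicAcsm_le [PseudoMetricSpace X] [OpensMeasurableSpace X]
    [MeasurableSingletonClass X] [IsProbabilityMeasure m] [m.IsOpenPosMeasure]
    {T : X → X} (hTmeas : Measurable T) (hT : m {x | ¬ ContinuousAt T x} = 0)
    {κ : Kernel X X} [IsMarkovKernel κ] {ε : ℝ} (hε : 0 < ε)
    (hsupp : ∀ x, (κ x).support = closure (Metric.ball (T x) ε))
    {B : Submodule ℝ (Lp ℝ 1 m)} {s : Seminorm ℝ B} (hB : IsAdaptedSpace B s)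
    {η D : ℝ} (hη1 : η < 1) (hD : 0 ≤ D)
    (hLY : LasotaYorke B s (IsKernelTransfer m (Kernel.deterministic T hTmeas)) η D)
    (hRLY : LasotaYorke B s (IsKernelTransfer m κ) η D) :
    {μ | IsErgodicAcsm m κ μ}.encard ≤ {μ | IsErgodicAcim m T μ}.encard ∧
      ((∃! μ, IsAcim m T μ) → ∃! μ, IsAcsm m κ μ) := by
  obtain ⟨L, hL, hLcomp, hLfixed⟩ := exists_transferOperator_of_lasotaYorke hB hη1 hD hLY
  obtain ⟨A, hA, hAcomp, hAfixed⟩ := exists_transferOperator_of_lasotaYorke hB hη1 hD hRLY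
  have key : ∀ h : Lp ℝ 1 m, 0 ≤ h → h ≠ 0 → A h = h → ∃ ν, IsErgodicAcim m T ν ∧
      ∃ U : Set X, IsOpen U ∧ (∀ᵐ x ∂m, x ∈ U ↔ 0 < h x) ∧ ν (interior (closure U))ᶜ = 0 := by
    intro h h0 hne hfix
    -- The fixed point property of singletons says that stationary densities lie in `B`.
    obtain ⟨g, hg, -⟩ := hAfixed {h} (convex_singleton h) isClosed_singleton
      (by simpa using hfix) (Set.singleton_nonempty h)
    rw [Set.mem_singleton_iff] at hg
    obtain ⟨h', hh', hcont⟩ := hB.null_discontinuities g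
    rw [hg] at hh'
    obtain ⟨U, hU, hUh⟩ := exists_isOpen_ae_eq_support h hh' hcont
    have hκU : ∀ᵐ x ∂m, x ∈ U → κ x Uᶜ = 0 := by
      filter_upwards [hUh, kernel_compl_eq_zero_of_stationary hA h0 hfix hU.measurableSet
        (hUh.mono fun x hx => hx.2)] with x hx hx' hxU
      exact hx' (hx.1 hxU)
    have hmW : m (interior (closure U)) ≠ 0 := by
      intro hz
      refine hne (Lp.ext ?_)
      filter_upwards [hUh, measure_eq_zero_iff_ae_notMem.1
        (measure_mono_null hU.subset_interior_closure hz), (Lp.coeFn_nonneg h).2 h0,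
        Lp.coeFn_zero ℝ 1 m] with x hx hxU hx0 hzero
      rw [hzero]
      exact le_antisymm (not_lt.1 fun hpos => hxU (hx.2 hpos)) hx0
    have hTW : ∀ᵐ x ∂m, x ∈ interior (closure U) →
        Kernel.deterministic T hTmeas x (interior (closure U))ᶜ = 0 := by
      filter_upwards [ae_mem_interior_closure hT hε hsupp hU hκU] with x hx hxW
      rw [Kernel.deterministic_apply' _ _ isOpen_interior.measurableSet.compl,
        Set.indicator_of_notMem (Set.notMem_compl_iff.2 (hx hxW))]
    obtain ⟨ν, hν, hνW⟩ := exists_isErgodicAcsm_of_invariant hL hLcomp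
      (fun C h1 h2 h3 h4 => let ⟨g, hg⟩ := hLfixed C h1 h2 h3 h4; ⟨g, hg⟩)
      isOpen_interior.measurableSet hmW hTW
    exact ⟨ν, (isErgodicAcim_iff_isErgodicAcsm_deterministic hTmeas).2 hν, U, hU, hUh, hνW⟩
  have hne0 : ∀ h : Lp ℝ 1 m, ∫ x, h x ∂m = 1 → h ≠ 0 := by
    rintro h h1 rfl
    rw [integral_congr_ae (Lp.coeFn_zero ℝ 1 m)] at h1
    simp at h1
  constructor
  · have hex : ∀ μ, IsErgodicAcsm m κ μ → ∃ ν, IsErgodicAcim m T ν ∧ ∃ h : Lp ℝ 1 m,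
        (0 ≤ h ∧ ∫ x, h x ∂m = 1 ∧ A h = h ∧ densityMeasure h = μ) ∧ ∃ U : Set X, IsOpen U ∧
          (∀ᵐ x ∂m, x ∈ U ↔ 0 < h x) ∧ ν (interior (closure U))ᶜ = 0 := by
      intro μ hμ
      obtain ⟨h, h0, h1, hfix, hhμ⟩ := hμ.isAcsm.exists_density hA
      obtain ⟨ν, hν, hU⟩ := key h h0 (hne0 h h1) hfix
      exact ⟨ν, hν, h, ⟨h0, h1, hfix, hhμ⟩, hU⟩
    choose! Φ hΦ h hh U hU hUh hΦU using hex
    refine Set.encard_le_encard_of_injOn (f := Φ) (fun μ hμ => hΦ μ hμ) ?_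
    intro μ hμ ν hν heq
    by_contra hne
    obtain ⟨h0, h1, hfix, hhμ⟩ := hh μ hμ
    obtain ⟨k0, k1, kfix, hhν⟩ := hh ν hν
    have hne' : h μ ≠ h ν := fun h => hne (by rw [← hhμ, ← hhν, h])
    have hp : IsProbabilityMeasure (Φ μ) := (hΦ μ hμ).isAcim.isProbabilityMeasure
    exact ne_of_ae_disjoint (hU μ hμ) (hU ν hν) (hUh μ hμ) (hUh ν hν)
      (ae_disjoint_of_ergodic hA h0 k0 h1 k1 hfix kfix (hhμ.symm ▸ hμ) (hhν.symm ▸ hν) hne')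
      (hΦU μ hμ) (hΦU ν hν) heq
  · intro huniq
    obtain ⟨μ, hμ, -⟩ := exists_isErgodicAcsm_of_invariant (W := Set.univ) hA hAcomp
      (fun C h1 h2 h3 h4 => let ⟨g, hg⟩ := hAfixed C h1 h2 h3 h4; ⟨g, hg⟩)
      MeasurableSet.univ (by simp) (by simp)
    refine ⟨μ, hμ.isAcsm, fun ν hν => ?_⟩
    obtain ⟨h, -, h1, hfix, rfl⟩ := hμ.isAcsm.exists_density hA
    obtain ⟨k, -, k1, kfix, rfl⟩ := hν.exists_density hA
    by_contra hne
    obtain ⟨f, g, f0, g0, hf, hg, ffix, gfix, hdisj⟩ :=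
      exists_disjoint_stationary hA k1 h1 kfix hfix fun h => hne (by rw [h])
    obtain ⟨ν₁, hν₁, U, hU, hUf, hνU⟩ := key f f0 hf ffix
    obtain ⟨ν₂, hν₂, V, hV, hVg, hνV⟩ := key g g0 hg gfix
    have hp := hν₁.isAcim.isProbabilityMeasure
    exact ne_of_ae_disjoint hU hV hUf hVg hdisj hνU hνV (huniq.unique hν₁.isAcim hν₂.isAcim)

end Comparison

/-! ### Normalized Lebesgue measure -/

section Lebesgue

variable {q : ℕ} {M : Set (EuclideanSpace ℝ (Fin q))}

theorem normalizedLebesgue_apply (hM : IsCompact M) (S : Set M) :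
    normalizedLebesgue M S = (volume M)⁻¹ * volume (Subtype.val '' S) := by
  rw [normalizedLebesgue, Measure.smul_apply, comap_subtype_coe_apply hM.measurableSet,
    smul_eq_mul]

theorem isProbabilityMeasure_normalizedLebesgue (hM_ne : M.Nonempty) (hM : IsCompact M)
    (hM_int : closure (interior M) = M) : IsProbabilityMeasure (normalizedLebesgue M) := by
  refine ⟨?_⟩
  rw [normalizedLebesgue_apply hM, Set.image_univ, Subtype.range_coe]
  refine ENNReal.inv_mul_cancel ?_ hM.measure_lt_top.ne
  have hne : (interior M).Nonempty := by rwa [← closure_nonempty_iff, hM_int]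
  exact ((isOpen_interior.measure_pos volume hne).trans_le (measure_mono interior_subset)).ne'

theorem isOpenPosMeasure_normalizedLebesgue (hM : IsCompact M)
    (hM_int : closure (interior M) = M) : (normalizedLebesgue M).IsOpenPosMeasure := by
  refine ⟨fun O hO hne => ?_⟩
  obtain ⟨V, hV, rfl⟩ := isOpen_induced_iff.1 hO
  obtain ⟨⟨x, hxM⟩, hxV⟩ := hne
  rw [normalizedLebesgue_apply hM, Subtype.image_preimage_coe]
  refine mul_ne_zero (ENNReal.inv_ne_zero.2 hM.measure_lt_top.ne) ?_
  have hne : (V ∩ interior M).Nonempty :=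
    mem_closure_iff.1 (hM_int.symm ▸ hxM) V hV hxV
  refine (((hV.inter isOpen_interior).measure_pos volume hne).trans_le (measure_mono ?_)).ne'
  exact fun y hy => ⟨interior_subset hy.2, hy.1⟩

end Lebesgue

theorem corollary1 {q : ℕ} (M : Set (EuclideanSpace ℝ (Fin q)))
    (hM_ne : M.Nonempty) (hM_compact : IsCompact M) (hM_int : closure (interior M) = M)
    (T : M → M)
    (hT_disc : normalizedLebesgue M {x | ¬ ContinuousAt T x} = 0)
    (hT_nonsing : Measure.QuasiMeasurePreserving T (normalizedLebesgue M) (normalizedLebesgue M))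
    (P : ℝ → Kernel M M)
    (hP_markov : ∀ ε > 0, IsMarkovKernel (P ε))
    (hP1 : ∀ ε > 0, ∀ x : M, P ε x ≪ normalizedLebesgue M)
    (hP2 : ∀ ε > 0, ∀ x : M, (P ε x).support = closure (Metric.ball (T x) ε))
    (B : Submodule ℝ (Lp ℝ 1 (normalizedLebesgue M))) (s : Seminorm ℝ B)
    (hB : IsAdaptedSpace B s)
    (η D : ℝ) (hη0 : 0 < η) (hη1 : η < 1) (hD : 0 < D)
    (hLY : LasotaYorke B s (IsTransfer (normalizedLebesgue M) T) η D)
    (hRLY : ∃ ε₁ > 0, ∀ ε > 0, ε < ε₁ →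
      LasotaYorke B s (IsRandomTransfer (normalizedLebesgue M) (P ε)) η D) :
    {μ | IsErgodicAcim (normalizedLebesgue M) T μ}.Finite ∧
    ∃ ε₀ > 0, ∀ ε > 0, ε < ε₀ →
      {μ | IsErgodicAcsm (normalizedLebesgue M) (P ε) μ}.encard ≤
          {μ | IsErgodicAcim (normalizedLebesgue M) T μ}.encard ∧
      ((∃! μ, IsAcim (normalizedLebesgue M) T μ) →
        ∃! μ, IsAcsm (normalizedLebesgue M) (P ε) μ) := by
  have hprob := isProbabilityMeasure_normalizedLebesgue hM_ne hM_compact hM_int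
  have hpos := isOpenPosMeasure_normalizedLebesgue hM_compact hM_int
  have hT := hT_nonsing.measurable
  have hLY' := hLY.mono fun _ _ h => h.isKernelTransfer hT
  refine ⟨?_, ?_⟩
  · obtain ⟨L, hL, hLcomp, -⟩ := exists_transferOperator_of_lasotaYorke hB hη1 hD.le hLY'
    simpa only [isErgodicAcim_iff_isErgodicAcsm_deterministic hT] using
      finite_isErgodicAcsm hL hLcomp
  · obtain ⟨ε₁, hε₁, hRLY⟩ := hRLY
    refine ⟨ε₁, hε₁, fun ε hε hlt => ?_⟩
    have := hP_markov ε hε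
    exact encard_isErgodicAcsm_le hT hT_disc hε (hP2 ε hε) hB hη1 hD.le hLY'
      ((hRLY ε hε hlt).mono fun _ _ h => h.isKernelTransfer (hP1 ε hε))
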